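/- **Theorem 1.1.** Let $\mathfrak o$ be a compact discrete valuation ring with maximal ideal $\wp$ and finite residue field $\mathfrak o/\wp=\mathbb F_q$ of characteristic $2$. If $\mathrm{char}\,\mathfrak o=0$, let $\mathrm e$ be its ramification index, defined by $2\mathfrak o=\wp^{\mathrm e}$. For $i\ge 1$ put $\mathfrak o_i=\mathfrak o/\wp^i$. Let $r\ge 2$, $\ell=\lceil r/2\rceil$, $\ell'=\lfloor r/2\rfloor$, and $$\mathbf N_r(\mathfrak o)=\begin{cases} q^{\lfloor \ell'/2\rfloor} & \text{if } \mathrm{char}\,\mathfrak o=2,\\ q^{\lfloor \ell'/2\rfloor} & \text{if } \mathrm{char}\,\mathfrak o=0 \text{ and } \ell'\le 2\mathrm e,\\ 2q^{\mathrm e} & \text{if } \mathrm{char}\,\mathfrak o=0 \text{ and } \ell'>2\mathrm e.\end{cases}$$ Then there exists a regular representation $\rho$ of $\mathrm{GL}_2(\mathfrak o_r)$ whose restriction to $\mathrm{SL}_2(\mathfrak o_r)$ has at least $\mathbf N_r(\mathfrak o)$ pairwise inequivalent irreducible constituents. Here representations are finite-dimensional and complex, and regularity is defined as follows. Let $\pi$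 be a uniformizer of $\mathfrak o$ and $\psi:\mathfrak o_r\to\mathbb C^\times$ an additive character with $\psi(\pi^{r-1})\ne 1$. For $A\in M_2(\mathfrak o_{\ell'})$ let $\psi_A$ be the character $I+\pi^\ell B\mapsto\psi(\pi^\ell\,\mathrm{trace}(\tilde A B))$ of the group $M^\ell=I+\pi^\ell M_2(\mathfrak o_r)$, where $\tilde A\in M_2(\mathfrak o_r)$ is any lift of $A$. The matrix $A$ is cyclic if there is $v\in\mathfrak o_{\ell'}^2$ such that $v$ and $Av$ generate $\mathfrak o_{\ell'}^2$. A representation $\rho$ of $\mathrm{GL}_2(\mathfrak o_r)$ is regular if it is irreducible and every $A$ for which $\psi_A$ occurs in $\rho|_{M^\ell}$ is cyclic; this does not depend on the choice of $\pi$ and $\psi$. -/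

import Mathlib

/-! Regular representations of `GL₂(𝔬/℘^r)` and irreducible constituents of their restriction to
`SL₂(𝔬/℘^r)`, for a discrete valuation ring `𝔬` with maximal ideal `℘`. -/

universe u v w

namespace RegularBranching

open IsLocalRing

/-- The quotient `𝔬/℘^r`. -/
abbrev ORing (𝔬 : Type u) [CommRing 𝔬] [IsLocalRing 𝔬] (r : ℕ) : Type u :=
  𝔬 ⧸ (maximalIdeal 𝔬) ^ r

/-- The reduction map `𝔬 → 𝔬/℘^r`. -/
abbrev red (𝔬 : Type u) [CommRing 𝔬] [IsLocalRing 𝔬] (r : ℕ) : 𝔬 →+* ORing 𝔬 r :=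
  Ideal.Quotient.mk ((maximalIdeal 𝔬) ^ r)

/-- A `2 × 2` matrix `A` over `R` is cyclic if there is a vector `v` such that `v` and `A v`
generate `R²`. -/
def IsCyclicMatrix {R : Type u} [CommRing R] (A : Matrix (Fin 2) (Fin 2) R) : Prop :=
  ∃ v : Fin 2 → R, Submodule.span R {v, A.mulVec v} = ⊤

/-- The character `ψ_A(1 + π^ℓ B) = ψ(π^ℓ tr(A B))` of the congruence subgroup
`M^ℓ = 1 + π^ℓ M₂(𝔬/℘^r)`, where `ℓ = ⌈r/2⌉`, occurs in the restriction of `ρ` to `M^ℓ`.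
The matrix, given modulo `℘^⌊r/2⌋`, is represented by a lift `A` to `𝔬`. -/
def CharacterOccurs {𝔬 : Type u} [CommRing 𝔬] [IsLocalRing 𝔬] {r : ℕ}
    {V : Type v} [AddCommGroup V] [Module ℂ V]
    (ρ : Representation ℂ (Matrix.GeneralLinearGroup (Fin 2) (ORing 𝔬 r)) V)
    (π : 𝔬) (ψ : AddChar (ORing 𝔬 r) ℂ) (A : Matrix (Fin 2) (Fin 2) 𝔬) : Prop :=
  ∃ x : V, x ≠ 0 ∧
    ∀ (g : Matrix.GeneralLinearGroup (Fin 2) (ORing 𝔬 r))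
      (B : Matrix (Fin 2) (Fin 2) (ORing 𝔬 r)),
      (g : Matrix (Fin 2) (Fin 2) (ORing 𝔬 r)) = 1 + red 𝔬 r (π ^ ((r + 1) / 2)) • B →
        ρ g x = ψ (red 𝔬 r (π ^ ((r + 1) / 2)) * (A.map (red 𝔬 r) * B).trace) • x

/-- A representation of `GL₂(𝔬/℘^r)` is regular if it is irreducible and every character `ψ_A` of
`M^⌈r/2⌉` occurring in it has a matrix `A` that is cyclic modulo `℘^⌊r/2⌋`. Here `π` is a
uniformizer and `ψ` is an additive character of `𝔬/℘^r` with `ψ(π^(r-1)) ≠ 1`; regularity does not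
depend on their choice, and we require the condition for all of them. -/
structure IsRegular {𝔬 : Type u} [CommRing 𝔬] [IsLocalRing 𝔬] {r : ℕ}
    {V : Type v} [AddCommGroup V] [Module ℂ V]
    (ρ : Representation ℂ (Matrix.GeneralLinearGroup (Fin 2) (ORing 𝔬 r)) V) : Prop where
  irreducible : ρ.IsIrreducible
  cyclic : ∀ (π : 𝔬) (ψ : AddChar (ORing 𝔬 r) ℂ), Irreducible π →
    ψ (red 𝔬 r (π ^ (r - 1))) ≠ 1 →
    ∀ A : Matrix (Fin 2) (Fin 2) 𝔬, CharacterOccurs ρ π ψ A →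
      IsCyclicMatrix (A.map (red 𝔬 (r / 2)))

/-- The restriction of a representation of `GL₂(R)` to `SL₂(R)`. -/
def resSL {R : Type u} [CommRing R] {V : Type v} [AddCommGroup V] [Module ℂ V]
    (ρ : Representation ℂ (Matrix.GeneralLinearGroup (Fin 2) R) V) :
    Representation ℂ (Matrix.SpecialLinearGroup (Fin 2) R) V :=
  ρ.comp Matrix.SpecialLinearGroup.toGL

/-- The representation `σ` has at least `n` pairwise inequivalent irreducible constituents. (For the
finite groups considered here `σ` is semisimple, so that every irreducible constituent is
equivalent to a subrepresentation.) -/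
def HasAtLeastConstituents {G : Type w} [Group G] {V : Type v} [AddCommGroup V] [Module ℂ V]
    (σ : Representation ℂ G V) (n : ℕ) : Prop :=
  ∃ W : Fin n → Subrepresentation σ,
    (∀ i, (W i).toRepresentation.IsIrreducible) ∧
    ∀ i j, i ≠ j → IsEmpty ((W i).toRepresentation.Equiv (W j).toRepresentation)

/-- The ramification index `e`, i.e. the valuation of `2`; it is used only in characteristic `0`. -/
noncomputable def ramificationIndex (𝔬 : Type u) [CommRing 𝔬] [IsDomain 𝔬]
    [IsDiscreteValuationRing 𝔬] : ℕ :=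
  (IsDiscreteValuationRing.addVal 𝔬 (2 : 𝔬)).toNat

/-- If `2 ≠ 0` in `𝔬`, the ramification index is characterized by `2𝔬 = ℘^e`. -/
theorem span_two_eq_pow_iff (𝔬 : Type u) [CommRing 𝔬] [IsDomain 𝔬] [IsDiscreteValuationRing 𝔬]
    (h2 : (2 : 𝔬) ≠ 0) (e : ℕ) :
    Ideal.span {(2 : 𝔬)} = (maximalIdeal 𝔬) ^ e ↔ e = ramificationIndex 𝔬 := by
  obtain ⟨π, hπ⟩ := IsDiscreteValuationRing.exists_irreducible 𝔬
  have hm := hπ.maximalIdeal_eq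
  obtain ⟨n, u, hu⟩ := IsDiscreteValuationRing.eq_unit_mul_pow_irreducible h2 hπ
  have hn : ramificationIndex 𝔬 = n := by
    simp [ramificationIndex, IsDiscreteValuationRing.addVal_def _ u hπ n hu]
  rw [hm, Ideal.span_singleton_pow, Ideal.span_singleton_eq_span_singleton, hn]
  have ha : Associated (2 : 𝔬) (π ^ n) := by
    rw [hu, mul_comm]
    exact (Associated.refl _).symm.trans ⟨u, rfl⟩ |>.symm
  constructor
  · intro h
    have h' := ha.symm.trans h
    have h1 := (pow_dvd_pow_iff hπ.ne_zero hπ.not_isUnit).1 h'.dvd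
    have h3 := (pow_dvd_pow_iff hπ.ne_zero hπ.not_isUnit).1 h'.symm.dvd
    omega
  · rintro rfl
    exact ha

/-- The number `N_r(𝔬)`, where `q = |𝔬/℘|` and `ℓ' = ⌊r/2⌋`: it is `q^⌊ℓ'/2⌋` if `𝔬` has
characteristic `2`, or if `𝔬` has characteristic `0` and `ℓ' ≤ 2e`; and it is `2q^e` if `𝔬` has
characteristic `0` and `2e < ℓ'`. -/
noncomputable def minNumber (𝔬 : Type u) [CommRing 𝔬] [IsDomain 𝔬] [IsDiscreteValuationRing 𝔬]
    (r : ℕ) : ℕ :=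
  if ringChar 𝔬 = 2 then
    Nat.card (ResidueField 𝔬) ^ (r / 2 / 2)
  else if r / 2 ≤ 2 * ramificationIndex 𝔬 then
    Nat.card (ResidueField 𝔬) ^ (r / 2 / 2)
  else
    2 * Nat.card (ResidueField 𝔬) ^ ramificationIndex 𝔬

end RegularBranching

/-! Take `A` nilpotent with lower left entry `1`, and an irreducible `ρ` of `GL₂(𝔬_r)` containing
`ψ_A`. By Clifford theory all characters of the congruence subgroup in `ρ` are conjugate to `ψ_A`;
none comes from a matrix that is scalar modulo `℘`, so `ρ` is regular.

The conjugates of `ψ_A` by `diag(u, 1)`, `u` a unit, also occur in `ρ`, and each occurs in some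
irreducible constituent of the restriction to `SL₂`. If two such constituents are isomorphic,
Clifford theory in `SL₂` makes their characters conjugate. On upper unipotents, `diag(u, 1)`
rescales the argument of `ψ` by `u⁻¹`, and `s` in `SL₂` rescales it by the square of `s 1 1`
(`nilpotentCharacter_conj`). So the two units agree modulo squares and `℘^ℓ'`.

The number of constituents is therefore at least the index of the squares in the units of `𝔬_ℓ'`,
which equals the number of square roots of `1` there. Enough of these have the form `±(1 + π^(ℓ'-k)
t)` (`minNumber_le_card_sqrtOne`). -/

namespace RegularBranching

/-! ### Clifford theory for eigenvectors of a subgroup. -/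

section Representations

variable {G : Type*} [Group G] {V : Type*} [AddCommGroup V] [Module ℂ V]

/-- A vector on which the elements of `K` act through the scalars `χ`. -/
def IsEigenvector (ρ : Representation ℂ G V) (K : Set G) (χ : G → ℂ) (x : V) : Prop :=
  x ≠ 0 ∧ ∀ k ∈ K, ρ k x = χ k • x

/-- The image in `ρ` of a subrepresentation of a subrepresentation of `ρ`. -/
def subrepMap {ρ : Representation ℂ G V} (W : Subrepresentation ρ)
    (U : Subrepresentation W.toRepresentation) : Subrepresentation ρ where
  toSubmodule := U.toSubmodule.map W.toSubmodule.subtype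
  apply_mem_toSubmodule g v hv := by
    obtain ⟨u, hu, rfl⟩ := hv
    exact ⟨_, U.apply_mem_toSubmodule g hu, rfl⟩

/-- A minimal subrepresentation containing a `χ`-eigenvector is irreducible: Maschke splits it along
any `U`, both components of the eigenvector satisfy the same equations, and a nonzero one forces its
summand to be everything. -/
theorem exists_irreducible_subrep [Finite G] [FiniteDimensional ℂ V]
    (ρ : Representation ℂ G V) (K : Set G) (χ : G → ℂ) {x : V} (hx : IsEigenvector ρ K χ x) :
    ∃ W : Subrepresentation ρ, W.toRepresentation.IsIrreducible ∧
      ∃ y, IsEigenvector W.toRepresentation K χ y := by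
  let P : Submodule ℂ V → Prop := fun N =>
    ∃ W : Subrepresentation ρ, W.toSubmodule = N ∧ ∃ y, IsEigenvector W.toRepresentation K χ y
  have hP : {N | P N}.Nonempty := by
    refine ⟨⊤, ⊤, rfl, ⟨x, trivial⟩, fun h => hx.1 (congrArg Subtype.val h), fun k hk => ?_⟩
    exact Subtype.ext (hx.2 k hk)
  obtain ⟨N, ⟨W, rfl, y, hy⟩, hmin⟩ := wellFounded_lt.has_min {N | P N} hP
  refine ⟨W, ?_, y, hy⟩
  have key : ∀ U : Subrepresentation W.toRepresentation,
      (∃ z ∈ U.toSubmodule, IsEigenvector W.toRepresentation K χ z) → U = ⊤ := by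
    rintro U ⟨z, hzU, hz⟩
    have h1 : P (subrepMap W U).toSubmodule := by
      refine ⟨_, rfl, ⟨z, z, hzU, rfl⟩, fun h => hz.1 ?_, fun k hk => ?_⟩
      · have h' : (z : V) = 0 := congrArg Subtype.val h
        exact Subtype.ext h'
      · have h' : ρ k z = χ k • (z : V) := congrArg Subtype.val (hz.2 k hk)
        exact Subtype.ext h'
    have h2 : (subrepMap W U).toSubmodule ≤ W.toSubmodule := by
      rintro _ ⟨u, -, rfl⟩
      exact u.2
    have h3 := eq_of_le_of_not_lt h2 (hmin _ h1)
    apply Subrepresentation.toSubmodule_injective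
    refine (Submodule.eq_top_iff').2 fun w => ?_
    have : (w : V) ∈ (subrepMap W U).toSubmodule := by
      rw [h3]
      exact w.2
    obtain ⟨u, hu, huw⟩ := this
    rwa [← Subtype.ext huw]
  refine { exists_pair_ne := ⟨⊥, ⊤, fun h => hy.1 ?_⟩, eq_bot_or_eq_top := fun U => ?_ }
  · have : y ∈ (⊤ : Subrepresentation W.toRepresentation).toSubmodule := trivial
    rw [← h] at this
    exact this
  · have : NeZero (Nat.card G : ℂ) := ⟨Nat.cast_ne_zero.2 Nat.card_pos.ne'⟩
    obtain ⟨U', hU⟩ := exists_isCompl U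
    have hsup : U.toSubmodule ⊔ U'.toSubmodule = ⊤ :=
      congrArg Subrepresentation.toSubmodule hU.sup_eq_top
    have hinf : U.toSubmodule ⊓ U'.toSubmodule = ⊥ :=
      congrArg Subrepresentation.toSubmodule hU.inf_eq_bot
    obtain ⟨a, ha, b, hb, hab⟩ := Submodule.mem_sup.1 (hsup ▸ Submodule.mem_top (x := y))
    have hdec : ∀ k ∈ K, W.toRepresentation k a = χ k • a ∧ W.toRepresentation k b = χ k • b := by
      intro k hk
      have h := hy.2 k hk
      rw [← hab, map_add, smul_add] at h
      -- The left side lies in `U` and the right side in `U'`, so both vanish.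
      have h1 : W.toRepresentation k a - χ k • a = χ k • b - W.toRepresentation k b := by
        rw [sub_eq_sub_iff_add_eq_add, h, add_comm]
      have h2 : W.toRepresentation k a - χ k • a ∈ U.toSubmodule ⊓ U'.toSubmodule := by
        refine ⟨U.toSubmodule.sub_mem (U.apply_mem_toSubmodule k ha)
          (U.toSubmodule.smul_mem _ ha), ?_⟩
        rw [h1]
        exact U'.toSubmodule.sub_mem (U'.toSubmodule.smul_mem _ hb) (U'.apply_mem_toSubmodule k hb)
      rw [hinf, Submodule.mem_bot] at h2
      exact ⟨sub_eq_zero.1 h2, (sub_eq_zero.1 (h1.symm.trans h2)).symm⟩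
    by_cases ha0 : a = 0
    · left
      have hb0 : b ≠ 0 := fun h => hy.1 (by rw [← hab, ha0, h, add_zero])
      have := key U' ⟨b, hb, hb0, fun k hk => (hdec k hk).2⟩
      rw [← hU.inf_eq_bot, this, inf_top_eq]
    · right
      exact key U ⟨a, ha, ha0, fun k hk => (hdec k hk).1⟩

/-- The subrepresentation generated by a vector. -/
def subrepSpan (ρ : Representation ℂ G V) (x : V) : Subrepresentation ρ where
  toSubmodule := Submodule.span ℂ (Set.range fun g => ρ g x)
  apply_mem_toSubmodule g v hv := by
    induction hv using Submodule.span_induction with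
    | mem y hy =>
      obtain ⟨h, rfl⟩ := hy
      exact Submodule.subset_span ⟨g * h, by simp⟩
    | zero => simp
    | add y z _ _ hy hz => rw [map_add]; exact Submodule.add_mem _ hy hz
    | smul a y _ hy => rw [map_smul]; exact Submodule.smul_mem _ _ hy

theorem span_orbit_eq_top (ρ : Representation ℂ G V) [ρ.IsIrreducible] {x : V} (hx : x ≠ 0) :
    Submodule.span ℂ (Set.range fun g => ρ g x) = ⊤ := by
  have hmem : x ∈ (subrepSpan ρ x).toSubmodule := Submodule.subset_span ⟨1, by simp⟩
  rcases eq_bot_or_eq_top (subrepSpan ρ x) with h | h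
  · rw [h] at hmem
    exact absurd hmem hx
  · exact congrArg Subrepresentation.toSubmodule h

/-- Clifford: the characters of a normal subgroup which occur in an irreducible representation are
conjugate. -/
theorem exists_conj_of_isEigenvector [Finite G] (ρ : Representation ℂ G V) [ρ.IsIrreducible]
    (K : Subgroup G) [K.Normal] {χ χ' : G → ℂ} {x y : V} (hx : IsEigenvector ρ K χ x)
    (hy : IsEigenvector ρ K χ' y) : ∃ g : G, ∀ k ∈ K, χ' k = χ (g⁻¹ * k * g) := by
  classical
  have := Fintype.ofFinite G
  by_contra! hne
  have hmul : ∀ a ∈ K, ∀ b ∈ K, χ' (a * b) = χ' a * χ' b := by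
    intro a ha b hb
    have h1 := hy.2 _ (K.mul_mem ha hb)
    rw [map_mul, Module.End.mul_apply, hy.2 b hb, map_smul, hy.2 a ha, smul_smul] at h1
    rw [mul_comm (χ' a)]
    exact (smul_left_injective ℂ hy.1 h1).symm
  have hone : χ' 1 = 1 := by
    have h1 := hy.2 1 K.one_mem
    rw [map_one, Module.End.one_apply] at h1
    exact smul_left_injective ℂ hy.1 (by simpa using h1.symm)
  -- Up to the factor `|K|`, the projector onto the `χ'`-eigenspace. If `χ'` differs from every
  -- conjugate of `χ`, it kills the orbit of `x`, which spans `V`; but it cannot kill `y`.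
  let e : V →ₗ[ℂ] V := ∑ k : K, χ' (k⁻¹ : K) • ρ k
  have he : ∀ (m : K) (v : V), e (ρ m v) = χ' m • e v := by
    intro m v
    simp only [e, LinearMap.sum_apply, LinearMap.smul_apply, Finset.smul_sum, smul_smul]
    rw [← Equiv.sum_comp (Equiv.mulRight m⁻¹)]
    refine Finset.sum_congr rfl fun k _ => ?_
    rw [← Module.End.mul_apply, ← map_mul]
    congr 1
    · rw [← hmul _ m.2 _ (k⁻¹ : K).2]
      simp
    · simp
  have hzero : e = 0 := by
    refine LinearMap.ext_on (span_orbit_eq_top ρ hx.1) ?_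
    rintro _ ⟨g, rfl⟩
    obtain ⟨k, hk, hkne⟩ := hne g
    have hconj : g⁻¹ * k * g ∈ K := by
      simpa using (inferInstance : K.Normal).conj_mem k hk g⁻¹
    have h1 : ρ k (ρ g x) = χ (g⁻¹ * k * g) • ρ g x := by
      rw [← map_smul, ← hx.2 _ hconj, ← Module.End.mul_apply, ← Module.End.mul_apply, ← map_mul,
        ← map_mul]
      congr 2
      group
    have h2 := he ⟨k, hk⟩ (ρ g x)
    simp only [h1, map_smul] at h2
    by_contra h3
    exact hkne (smul_left_injective ℂ h3 h2).symm
  have hey : e y = (Fintype.card K : ℂ) • y := by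
    simp only [e, LinearMap.sum_apply, LinearMap.smul_apply]
    rw [Finset.sum_congr rfl (g := fun _ => y), Finset.sum_const, Finset.card_univ,
      Nat.cast_smul_eq_nsmul]
    intro k _
    rw [hy.2 _ k.2, smul_smul, ← hmul _ (k⁻¹ : K).2 _ k.2]
    simp [hone]
  rw [hzero, LinearMap.zero_apply, eq_comm, smul_eq_zero] at hey
  rcases hey with h | h
  · exact Fintype.card_ne_zero (Nat.cast_eq_zero.1 h)
  · exact hy.1 h

theorem isEigenvector_conj (ρ : Representation ℂ G V) (K : Subgroup G) [K.Normal] {χ : G → ℂ}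
    {x : V} (hx : IsEigenvector ρ K χ x) (g : G) :
    IsEigenvector ρ K (fun k => χ (g⁻¹ * k * g)) (ρ g x) := by
  refine ⟨fun h => hx.1 ?_, fun k hk => ?_⟩
  · rw [← Representation.inv_self_apply ρ g x, h, map_zero]
  · have hconj : g⁻¹ * k * g ∈ K := by
      simpa using (inferInstance : K.Normal).conj_mem k hk g⁻¹
    rw [← map_smul, ← hx.2 _ hconj, ← Module.End.mul_apply, ← Module.End.mul_apply, ← map_mul,
      ← map_mul]
    congr 2
    group

/-- The action of a group on its complex functions by right translation. -/
def rightTranslation (G : Type*) [Group G] : Representation ℂ G (G → ℂ) where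
  toFun g := LinearMap.funLeft ℂ ℂ fun h => h * g
  map_one' := by ext; simp [LinearMap.funLeft_apply]
  map_mul' a b := by ext; simp [LinearMap.funLeft_apply, mul_assoc]

-- Replaces induction: `χ` extended by zero shows that every character of `K` occurs in some
-- representation of `G`.
open Classical in
theorem isEigenvector_rightTranslation (K : Subgroup G) (χ : G → ℂ) (h1 : χ 1 = 1)
    (hmul : ∀ a ∈ K, ∀ b ∈ K, χ (a * b) = χ a * χ b) :
    IsEigenvector (rightTranslation G) K χ (fun g => if g ∈ K then χ g else 0) := by
  refine ⟨fun h => ?_, fun k hk => ?_⟩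
  · have := congrFun h 1
    simp [h1] at this
  · ext g
    change (if g * k ∈ K then χ (g * k) else 0) = χ k * (if g ∈ K then χ g else 0)
    by_cases hg : g ∈ K
    · rw [if_pos (K.mul_mem hg hk), if_pos hg, hmul _ hg _ hk, mul_comm]
    · rw [if_neg hg, if_neg (fun h => hg ((K.mul_mem_cancel_right hk).1 h)), mul_zero]

end Representations

end RegularBranching

namespace RegularBranching

open IsLocalRing

/-! ### Square roots of `1` and unit classes modulo squares in `𝔬/℘^n`. -/

section Counting

/-- In a finite commutative group the squares have index equal to the number of square roots
of `1`. -/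
theorem index_range_pow_two (M : Type*) [CommGroup M] [Finite M] :
    (powMonoidHom 2 : M →* M).range.index = Nat.card {x : M // x ^ 2 = 1} := by
  have h1 := (powMonoidHom 2 : M →* M).ker.card_mul_index
  have h2 := (powMonoidHom 2 : M →* M).range.card_mul_index
  rw [Subgroup.index_ker, ← h2, mul_comm] at h1
  exact (Nat.eq_of_mul_eq_mul_left Nat.card_pos h1).symm

variable {𝔬 : Type u} [CommRing 𝔬] [IsDomain 𝔬] [IsDiscreteValuationRing 𝔬]

theorem card_quotient_pow (k : ℕ) :
    Nat.card (ORing 𝔬 k) = Nat.card (ResidueField 𝔬) ^ k :=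
  cardQuot_pow_of_prime (IsDiscreteValuationRing.not_a_field 𝔬)

theorem finite_quotient_pow [Finite (ResidueField 𝔬)] (k : ℕ) : Finite (ORing 𝔬 k) := by
  have : Finite (𝔬 ⧸ maximalIdeal 𝔬) := ‹Finite (ResidueField 𝔬)›
  exact Ideal.finite_quotient_pow (IsNoetherian.noetherian _) k

theorem red_eq_zero_iff {π : 𝔬} (hπ : Irreducible π) (r : ℕ) (a : 𝔬) :
    red 𝔬 r a = 0 ↔ π ^ r ∣ a := by
  rw [Ideal.Quotient.eq_zero_iff_mem, hπ.maximalIdeal_eq, Ideal.span_singleton_pow,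
    Ideal.mem_span_singleton]

theorem red_eq_red_iff {π : 𝔬} (hπ : Irreducible π) (r : ℕ) (a b : 𝔬) :
    red 𝔬 r a = red 𝔬 r b ↔ π ^ r ∣ a - b := by
  rw [← sub_eq_zero, ← map_sub, red_eq_zero_iff hπ]

/-- The square root `1 + π^(n-k) t` of `1` modulo `π^n`, for `t` modulo `π^k`. -/
noncomputable def sqrtOne (π : 𝔬) (n k : ℕ) (t : ORing 𝔬 k) : ORing 𝔬 n :=
  red 𝔬 n (1 + π ^ (n - k) * t.out)

/-- In the expanded square, the cross term vanishes modulo `π^n` since `π^k ∣ 2`, the quadratic term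
since `2(n-k) ≥ n`. -/
theorem sqrtOne_sq {π : 𝔬} (hπ : Irreducible π) {n k : ℕ} (hk : 2 * k ≤ n)
    (h2 : π ^ k ∣ 2) (t : ORing 𝔬 k) : sqrtOne π n k t ^ 2 = 1 := by
  obtain ⟨a, ha⟩ := h2
  rw [sqrtOne, ← map_pow, ← map_one (red 𝔬 n), red_eq_red_iff hπ]
  have h1 : (1 + π ^ (n - k) * t.out) ^ 2 - 1 =
      π ^ (n - k) * π ^ k * (a * t.out) + π ^ (2 * (n - k)) * t.out ^ 2 := by
    linear_combination π ^ (n - k) * t.out * ha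
  rw [h1]
  refine dvd_add (Dvd.dvd.mul_right ?_ _) (Dvd.dvd.mul_right (pow_dvd_pow _ (by omega)) _)
  rw [← pow_add]
  exact pow_dvd_pow _ (by omega)

theorem sqrtOne_injective {π : 𝔬} (hπ : Irreducible π) {n k : ℕ} (hk : k ≤ n) :
    Function.Injective (sqrtOne π n k) := by
  intro s t h
  rw [sqrtOne, sqrtOne, red_eq_red_iff hπ, add_sub_add_left_eq_sub, ← mul_sub] at h
  have h1 : π ^ (n - k) * π ^ k ∣ π ^ (n - k) * (s.out - t.out) := by
    rwa [← pow_add, Nat.sub_add_cancel hk]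
  have h2 := (mul_dvd_mul_iff_left (pow_ne_zero _ hπ.ne_zero)).1 h1
  have hs : red 𝔬 k s.out = s := Quotient.out_eq s
  have ht : red 𝔬 k t.out = t := Quotient.out_eq t
  rw [← hs, ← ht]
  exact (red_eq_red_iff hπ k _ _).2 h2

/-- The square roots of `1` in the unit group are those in the ring. -/
def unitsSqrtOneEquiv (R : Type*) [CommRing R] :
    {x : Rˣ // x ^ 2 = 1} ≃ {x : R // x ^ 2 = 1} where
  toFun x := ⟨x.1, by rw [← Units.val_pow_eq_pow_val, x.2, Units.val_one]⟩
  invFun x := ⟨⟨x.1, x.1, by rw [← pow_two, x.2], by rw [← pow_two, x.2]⟩, Units.ext x.2⟩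
  left_inv _ := Subtype.ext (Units.ext rfl)
  right_inv _ := rfl

theorem pow_le_card_sqrtOne [Finite (ResidueField 𝔬)] {π : 𝔬} (hπ : Irreducible π) {n k : ℕ}
    (hk : 2 * k ≤ n) (h2 : π ^ k ∣ 2) :
    Nat.card (ResidueField 𝔬) ^ k ≤ Nat.card {x : ORing 𝔬 n // x ^ 2 = 1} := by
  have := finite_quotient_pow (𝔬 := 𝔬) n
  rw [← card_quotient_pow]
  refine Nat.card_le_card_of_injective (fun t => ⟨sqrtOne π n k t, sqrtOne_sq hπ hk h2 t⟩) ?_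
  intro s t h
  exact sqrtOne_injective hπ (by omega) (congrArg Subtype.val h)

theorem two_mul_pow_le_card_sqrtOne [Finite (ResidueField 𝔬)] {π : 𝔬} (hπ : Irreducible π)
    {n k : ℕ} (hk : 2 * k < n) (h2 : π ^ k ∣ 2) (h2' : ¬ π ^ (k + 1) ∣ 2) :
    2 * Nat.card (ResidueField 𝔬) ^ k ≤ Nat.card {x : ORing 𝔬 n // x ^ 2 = 1} := by
  have := finite_quotient_pow (𝔬 := 𝔬) n
  -- An equality would give `2 ≡ 0` modulo `π^(k+1)`, because `n - k ≥ k + 1`.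
  have hsign : ∀ s t : ORing 𝔬 k, sqrtOne π n k s ≠ -sqrtOne π n k t := by
    intro s t h
    rw [sqrtOne, sqrtOne, ← map_neg, red_eq_red_iff hπ] at h
    apply h2'
    have h3 : π ^ (k + 1) ∣ π ^ (n - k) := pow_dvd_pow _ (by omega)
    have h4 := dvd_sub ((pow_dvd_pow π (by omega : k + 1 ≤ n)).trans h)
      (h3.mul_right (s.out + t.out))
    convert h4 using 1
    ring
  have h1 : 2 * Nat.card (ResidueField 𝔬) ^ k = Nat.card (ORing 𝔬 k ⊕ ORing 𝔬 k) := by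
    have := finite_quotient_pow (𝔬 := 𝔬) k
    rw [Nat.card_sum, card_quotient_pow, two_mul]
  rw [h1]
  refine Nat.card_le_card_of_injective
    (Sum.elim (fun t => ⟨sqrtOne π n k t, sqrtOne_sq hπ hk.le h2 t⟩)
      (fun t => ⟨-sqrtOne π n k t, by rw [neg_sq, sqrtOne_sq hπ hk.le h2 t]⟩)) ?_
  have hinj := sqrtOne_injective hπ (by omega : k ≤ n)
  rintro (s | s) (t | t) h <;> have h := congrArg Subtype.val h <;>
    simp only [Sum.elim_inl, Sum.elim_inr] at h
  · rw [hinj h]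
  · exact absurd h (hsign _ _)
  · exact absurd h.symm (hsign _ _)
  · rw [hinj (neg_injective h)]

/-- With `ℓ' = r / 2`, the choice is `k = ⌊ℓ'/2⌋` when `2 = 0` or `ℓ' ≤ 2e`, and `k = e` when `ℓ' >
2e`, where the sign gives the factor `2`. -/
theorem minNumber_le_card_sqrtOne [Finite (ResidueField 𝔬)] [CharP (ResidueField 𝔬) 2] (r : ℕ) :
    minNumber 𝔬 r ≤ Nat.card {x : ORing 𝔬 (r / 2) // x ^ 2 = 1} := by
  obtain ⟨π, hπ⟩ := IsDiscreteValuationRing.exists_irreducible 𝔬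
  rw [minNumber]
  split_ifs with hchar he
  · refine pow_le_card_sqrtOne hπ (by omega) ?_
    have h2 : (2 : 𝔬) = 0 := by
      have := ringChar.Nat.cast_ringChar (R := 𝔬)
      rw [hchar] at this
      exact_mod_cast this
    rw [h2]
    exact dvd_zero _
  all_goals
    have h2 : (2 : 𝔬) ≠ 0 := by
      intro h
      have h1 : ringChar 𝔬 ∣ 2 := ringChar.dvd (by exact_mod_cast h)
      rcases (Nat.dvd_prime Nat.prime_two).1 h1 with h3 | h3
      · exact CharP.ringChar_ne_one h3
      · exact hchar h3
    have hspan := (span_two_eq_pow_iff 𝔬 h2 _).2 rfl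
    rw [hπ.maximalIdeal_eq, Ideal.span_singleton_pow,
      Ideal.span_singleton_eq_span_singleton] at hspan
  · exact pow_le_card_sqrtOne hπ (by omega) ((pow_dvd_pow _ (by omega)).trans hspan.symm.dvd)
  · refine two_mul_pow_le_card_sqrtOne hπ (by omega) hspan.symm.dvd fun h => ?_
    have h3 := (pow_dvd_pow_iff hπ.ne_zero hπ.not_isUnit).1 (h.trans hspan.dvd)
    omega

theorem isUnit_of_isUnit_red {n : ℕ} (hn : n ≠ 0) {a : 𝔬} (ha : IsUnit (red 𝔬 n a)) :
    IsUnit a := by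
  by_contra h
  have hnil : IsNilpotent (red 𝔬 n a) := by
    refine ⟨n, ?_⟩
    rw [← map_pow, Ideal.Quotient.eq_zero_iff_mem]
    exact Ideal.pow_mem_pow ((mem_maximalIdeal a).2 h) n
  have : Nontrivial (ORing 𝔬 n) := Ideal.Quotient.nontrivial_iff.2 fun h1 =>
    (maximalIdeal.isMaximal 𝔬).ne_top (Ideal.pow_eq_top_iff.1 h1 |>.resolve_right hn)
  exact hnil.not_isUnit ha

/-- There are `minNumber 𝔬 r` units which are pairwise inequivalent modulo squares and
`℘^⌊r/2⌋`. -/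
theorem exists_units_inequivalent_mod_squares [Finite (ResidueField 𝔬)]
    [CharP (ResidueField 𝔬) 2] {π : 𝔬} (hπ : Irreducible π) {r : ℕ} (hr : 2 ≤ r) :
    ∃ u : Fin (minNumber 𝔬 r) → 𝔬ˣ, ∀ i j, i ≠ j → ∀ d : 𝔬,
      ¬ π ^ (r / 2) ∣ u j - d ^ 2 * u i := by
  have := finite_quotient_pow (𝔬 := 𝔬) (r / 2)
  let M := (ORing 𝔬 (r / 2))ˣ
  let H : Subgroup M := (powMonoidHom 2 : M →* M).range
  have hcard : Nat.card (Fin (minNumber 𝔬 r)) ≤ Nat.card (M ⧸ H) := by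
    have h1 : Nat.card (M ⧸ H) = Nat.card {x : M // x ^ 2 = 1} := index_range_pow_two M
    rw [Nat.card_fin, h1, Nat.card_congr (unitsSqrtOneEquiv _)]
    exact minNumber_le_card_sqrtOne r
  obtain ⟨f⟩ : Nonempty (Fin (minNumber 𝔬 r) ↪ M ⧸ H) := by
    have := Fintype.ofFinite (M ⧸ H)
    rw [Nat.card_eq_fintype_card, Nat.card_eq_fintype_card] at hcard
    exact Function.Embedding.nonempty_of_card_le hcard
  have hlift : ∀ x : M, ∃ a : 𝔬ˣ, red 𝔬 (r / 2) a = x := by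
    intro x
    obtain ⟨a, ha⟩ := Ideal.Quotient.mk_surjective (x : ORing 𝔬 (r / 2))
    have hu : IsUnit a := isUnit_of_isUnit_red (n := r / 2) (by omega) (ha ▸ x.isUnit)
    exact ⟨hu.unit, ha⟩
  choose a ha using hlift
  refine ⟨fun i => a (f i).out, fun i j hij d hd => hij (f.injective ?_)⟩
  rw [← red_eq_red_iff hπ, map_mul, map_pow, ha, ha] at hd
  -- The congruence itself forces `d` to be a unit, so its square is a square in the unit group.
  have hdu : IsUnit (red 𝔬 (r / 2) d) := by
    have h1 : IsUnit (red 𝔬 (r / 2) d ^ 2 * ((f i).out : M)) := hd ▸ Units.isUnit _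
    exact (isUnit_pow_iff two_ne_zero).1 (isUnit_of_mul_isUnit_left h1)
  rw [← QuotientGroup.out_eq' (f i), ← QuotientGroup.out_eq' (f j), QuotientGroup.eq]
  refine ⟨hdu.unit, ?_⟩
  rw [powMonoidHom_apply, eq_inv_mul_iff_mul_eq, mul_comm]
  exact Units.ext hd.symm

end Counting

end RegularBranching

namespace RegularBranching

open IsLocalRing Matrix

/-! ### The congruence subgroup and its character attached to the nilpotent matrix. -/

section CongruenceSubgroup

variable {R : Type*} [CommRing R]

/-- The subgroup `1 + c M₂(R)` of `GL₂(R)`, for `c² = 0`. -/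
def congruenceSubgroup (c : R) (hc : c * c = 0) : Subgroup (GL (Fin 2) R) where
  carrier := {g | ∃ B : Matrix (Fin 2) (Fin 2) R, (g : Matrix (Fin 2) (Fin 2) R) = 1 + c • B}
  one_mem' := ⟨0, by simp⟩
  mul_mem' := by
    rintro g h ⟨B, hB⟩ ⟨C, hC⟩
    refine ⟨B + C, ?_⟩
    rw [Units.val_mul, hB, hC, add_mul, mul_add, mul_add, smul_mul_smul_comm, hc]
    simp only [mul_one, one_mul, zero_smul, add_zero, smul_add]
    abel
  inv_mem' := by
    rintro g ⟨B, hB⟩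
    refine ⟨-B, ?_⟩
    refine Units.inv_eq_of_mul_eq_one_right ?_
    rw [hB, add_mul, mul_add, mul_add, smul_mul_smul_comm, hc]
    simp

theorem mem_congruenceSubgroup {c : R} {hc : c * c = 0} {g : GL (Fin 2) R} :
    g ∈ congruenceSubgroup c hc ↔
      ∃ B : Matrix (Fin 2) (Fin 2) R, (g : Matrix (Fin 2) (Fin 2) R) = 1 + c • B :=
  Iff.rfl

instance (c : R) (hc : c * c = 0) : (congruenceSubgroup c hc).Normal where
  conj_mem := by
    rintro n ⟨B, hB⟩ g
    refine ⟨g * B * (g⁻¹ : GL (Fin 2) R), ?_⟩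
    rw [Units.val_mul, Units.val_mul, hB, mul_add, add_mul, mul_one, Units.mul_inv, mul_smul_comm,
      smul_mul_assoc]

/-- The function on `GL₂(R)` which restricts to the character `ψ_A` of a congruence subgroup,
for `A` the nilpotent matrix with lower left entry `1`. -/
def nilpotentCharacter (ψ : AddChar R ℂ) (g : GL (Fin 2) R) : ℂ :=
  ψ (g 0 1)

theorem nilpotentCharacter_mul (ψ : AddChar R ℂ) {c : R} {hc : c * c = 0} {g h : GL (Fin 2) R}
    (hg : g ∈ congruenceSubgroup c hc) (hh : h ∈ congruenceSubgroup c hc) :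
    nilpotentCharacter ψ (g * h) = nilpotentCharacter ψ g * nilpotentCharacter ψ h := by
  obtain ⟨B, hB⟩ := hg
  obtain ⟨C, hC⟩ := hh
  rw [nilpotentCharacter, nilpotentCharacter, nilpotentCharacter, ← AddChar.map_add_eq_mul]
  congr 1
  rw [Units.val_mul, hB, hC]
  simp only [Matrix.mul_apply, Fin.sum_univ_two, Matrix.add_apply, Matrix.smul_apply,
    Matrix.one_apply_eq, Matrix.one_apply_ne, ne_eq, zero_ne_one, not_false_eq_true, smul_eq_mul]
  linear_combination (B 0 0 * C 0 1 + B 0 1 * C 1 1) * hc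

/-- The upper unitriangular matrices. -/
def upperUnipotent (t : R) : SpecialLinearGroup (Fin 2) R :=
  ⟨!![1, t; 0, 1], by simp [Matrix.det_fin_two]⟩

theorem coe_upperUnipotent (t : R) :
    (upperUnipotent t : Matrix (Fin 2) (Fin 2) R) = !![1, t; 0, 1] :=
  rfl

theorem upperUnipotent_mem {c : R} (hc : c * c = 0) (z : R) :
    SpecialLinearGroup.toGL (upperUnipotent (c * z)) ∈ congruenceSubgroup c hc := by
  refine ⟨!![0, z; 0, 0], ?_⟩
  ext i j
  fin_cases i <;> fin_cases j <;> simp [coe_upperUnipotent]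

/-- The source of the squares: `g` multiplies the upper right entry by `(g 1 1)² / det g`. This is
`u⁻¹` for `diag(u, 1)` and a square for `g` in `SL₂`. -/
theorem nilpotentCharacter_conj (ψ : AddChar R ℂ) (g : GL (Fin 2) R) (t : R) {w : R}
    (hw : w * (g : Matrix (Fin 2) (Fin 2) R).det = 1) :
    nilpotentCharacter ψ (g⁻¹ * SpecialLinearGroup.toGL (upperUnipotent t) * g) =
      ψ (w * g 1 1 ^ 2 * t) := by
  have hinv : ((g⁻¹ : GL (Fin 2) R) : Matrix (Fin 2) (Fin 2) R) =
      w • (g : Matrix (Fin 2) (Fin 2) R).adjugate := by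
    refine Units.inv_eq_of_mul_eq_one_right ?_
    rw [mul_smul_comm, Matrix.mul_adjugate, smul_smul, hw, one_smul]
  rw [nilpotentCharacter, Units.val_mul, Units.val_mul, hinv]
  congr 1
  simp only [SpecialLinearGroup.coe_GL_coe_matrix, coe_upperUnipotent, Matrix.adjugate_fin_two,
    Matrix.mul_apply, Fin.sum_univ_two, Matrix.smul_apply, smul_eq_mul, Matrix.of_apply,
    Matrix.cons_val', Matrix.cons_val_zero, Matrix.cons_val_one, Matrix.cons_val_fin_one]
  ring

/-- The diagonal matrix with entries `u` and `1`. -/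
def diagUnit (u : Rˣ) : GL (Fin 2) R where
  val := !![(u : R), 0; 0, 1]
  inv := !![((u⁻¹ : Rˣ) : R), 0; 0, 1]
  val_inv := by
    ext i j
    fin_cases i <;> fin_cases j <;> simp
  inv_val := by
    ext i j
    fin_cases i <;> fin_cases j <;> simp

/-- An irreducible representation of `GL₂(R)` containing the character `ψ_A`, where `A` is the
nilpotent matrix with lower left entry `1`, exists. -/
theorem exists_irreducible_nilpotentCharacter {R : Type u} [CommRing R] [Finite R]
    (ψ : AddChar R ℂ) (c : R) (hc : c * c = 0) :
    ∃ (V : Type u) (_ : AddCommGroup V) (_ : Module ℂ V) (_ : FiniteDimensional ℂ V)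
      (ρ : Representation ℂ (GL (Fin 2) R) V) (x : V), ρ.IsIrreducible ∧
        IsEigenvector ρ (congruenceSubgroup c hc) (nilpotentCharacter ψ) x := by
  classical
  have := Fintype.ofFinite R
  have hfin : FiniteDimensional ℂ (GL (Fin 2) R → ℂ) := inferInstance
  obtain ⟨W, hW, y, hy⟩ := exists_irreducible_subrep (rightTranslation (GL (Fin 2) R)) _ _
    (isEigenvector_rightTranslation (congruenceSubgroup c hc) (nilpotentCharacter ψ)
      (by simp [nilpotentCharacter]) (fun a ha b hb => nilpotentCharacter_mul ψ ha hb))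
  exact ⟨W.toSubmodule, inferInstance, inferInstance, inferInstance, W.toRepresentation, y, hW, hy⟩

end CongruenceSubgroup

/-! ### Cyclic matrices. -/

section Cyclic

theorem isCyclicMatrix_of_isUnit {R : Type*} [CommRing R] {A : Matrix (Fin 2) (Fin 2) R}
    (v : Fin 2 → R) (h : IsUnit (v 0 * A.mulVec v 1 - v 1 * A.mulVec v 0)) :
    IsCyclicMatrix A := by
  refine ⟨v, Submodule.eq_top_iff'.2 fun x => Submodule.mem_span_pair.2 ?_⟩
  obtain ⟨t, ht⟩ := h.exists_left_inv
  generalize A.mulVec v = w at *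
  -- Cramer's rule, with `t` the inverse of the determinant of `(v, A v)`.
  refine ⟨t * (x 0 * w 1 - x 1 * w 0), t * (v 0 * x 1 - v 1 * x 0), ?_⟩
  ext i
  fin_cases i
  · simp only [Pi.add_apply, Pi.smul_apply, smul_eq_mul, Fin.zero_eta]
    linear_combination x 0 * ht
  · simp only [Pi.add_apply, Pi.smul_apply, smul_eq_mul, Fin.mk_one]
    linear_combination x 1 * ht

variable {𝔬 : Type u} [CommRing 𝔬] [IsDomain 𝔬] [IsDiscreteValuationRing 𝔬]

/-- A matrix over a discrete valuation ring is cyclic modulo `℘^n` unless it is scalar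
modulo `℘`. -/
theorem isCyclicMatrix_or_scalar {π : 𝔬} (hπ : Irreducible π) (A : Matrix (Fin 2) (Fin 2) 𝔬)
    (n : ℕ) :
    IsCyclicMatrix (A.map (red 𝔬 n)) ∨
      ∃ (a : 𝔬) (N : Matrix (Fin 2) (Fin 2) 𝔬), A = a • 1 + π • N := by
  have hunit : ∀ a : 𝔬, ¬ π ∣ a → IsUnit (red 𝔬 n a) := by
    intro a ha
    refine IsUnit.map _ ?_
    by_contra h
    apply ha
    rwa [← mem_nonunits_iff, ← mem_maximalIdeal, hπ.maximalIdeal_eq,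
      Ideal.mem_span_singleton] at h
  -- For `v = (1,0), (0,1), (1,1)` the determinant of `(v, A v)` is `A 1 0`, `-A 0 1`, `A 1 0 + A 1
  -- 1 - A 0 0 - A 0 1`. If `π` divides all three, `A` is scalar modulo `π`.
  by_cases h10 : π ∣ A 1 0
  · by_cases h01 : π ∣ A 0 1
    · by_cases hd : π ∣ A 1 1 - A 0 0
      · right
        obtain ⟨x, hx⟩ := h10
        obtain ⟨y, hy⟩ := h01
        obtain ⟨z, hz⟩ := hd
        refine ⟨A 0 0, !![0, y; x, z], ?_⟩
        ext i j
        fin_cases i <;> fin_cases j <;> simp [hx, hy, ← hz]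
      · left
        refine isCyclicMatrix_of_isUnit ![1, 1] ?_
        have h1 : ¬ π ∣ A 1 0 + A 1 1 - (A 0 0 + A 0 1) := by
          intro h
          apply hd
          have := dvd_add (dvd_sub h h10) h01
          convert this using 1
          ring
        simpa [Matrix.mulVec, dotProduct, Fin.sum_univ_two] using hunit _ h1
    · left
      refine isCyclicMatrix_of_isUnit ![0, 1] ?_
      simpa [Matrix.mulVec, dotProduct, Fin.sum_univ_two] using (hunit _ h01).neg
  · left
    refine isCyclicMatrix_of_isUnit ![1, 0] ?_
    simpa [Matrix.mulVec, dotProduct, Fin.sum_univ_two] using hunit _ h10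

end Cyclic

/-! ### Regularity of `ρ` and the constituents of its restriction. -/

section Main

variable {𝔬 : Type u} [CommRing 𝔬] [IsDomain 𝔬] [IsDiscreteValuationRing 𝔬]

theorem exists_addChar_ne_one [Finite (ResidueField 𝔬)] {π : 𝔬} (hπ : Irreducible π) {r : ℕ}
    (hr : r ≠ 0) : ∃ ψ : AddChar (ORing 𝔬 r) ℂ, ψ (red 𝔬 r (π ^ (r - 1))) ≠ 1 := by
  have := finite_quotient_pow (𝔬 := 𝔬) r
  refine AddChar.exists_apply_ne_zero.2 fun h => ?_
  rw [red_eq_zero_iff hπ, pow_dvd_pow_iff hπ.ne_zero hπ.not_isUnit] at h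
  omega

/-- Every nonzero ideal of `𝔬/℘^r` contains `π^(r-1)`, where `ψ` is nontrivial. -/
theorem eq_zero_of_addChar_mul_eq_one {π : 𝔬} (hπ : Irreducible π) {r : ℕ}
    {ψ : AddChar (ORing 𝔬 r) ℂ} (hψ : ψ (red 𝔬 r (π ^ (r - 1))) ≠ 1) {t : ORing 𝔬 r}
    (ht : ∀ z, ψ (t * z) = 1) : t = 0 := by
  obtain ⟨a, rfl⟩ := Ideal.Quotient.mk_surjective t
  by_contra h
  have ha : a ≠ 0 := fun h0 => h (by rw [h0, map_zero])
  obtain ⟨k, w, rfl⟩ := IsDiscreteValuationRing.eq_unit_mul_pow_irreducible ha hπ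
  have hk : k < r := by
    by_contra hk
    exact h ((red_eq_zero_iff hπ r _).2 (Dvd.dvd.mul_left (pow_dvd_pow _ (by omega)) _))
  apply hψ
  have h1 : π ^ (r - 1) = w * π ^ k * (((w⁻¹ : 𝔬ˣ) : 𝔬) * π ^ (r - 1 - k)) := by
    rw [mul_mul_mul_comm, Units.mul_inv, one_mul, ← pow_add]
    congr 1
    omega
  rw [h1, map_mul]
  exact ht _

theorem red_pow_mul_self {π : 𝔬} (hπ : Irreducible π) (r : ℕ) :
    red 𝔬 r (π ^ ((r + 1) / 2)) * red 𝔬 r (π ^ ((r + 1) / 2)) = 0 := by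
  rw [← map_mul, red_eq_zero_iff hπ, ← pow_add]
  exact pow_dvd_pow _ (by omega)

/-- Let `a + πN` occur. Its character is trivial on conjugates of `1 + tE`, with `t = π^(r-1)` and
`E` the upper right matrix unit: `tπ = 0` removes `N`, and conjugates of `E` have trace `0`. The
nilpotent character takes the value `ψ(t) ≠ 1` at `1 + tE`, so the two are not conjugate. -/
theorem isRegular_of_nilpotentCharacter [Finite (ResidueField 𝔬)] {π : 𝔬} (hπ : Irreducible π)
    {r : ℕ} (hr : 2 ≤ r) {ψ : AddChar (ORing 𝔬 r) ℂ} (hψ : ψ (red 𝔬 r (π ^ (r - 1))) ≠ 1)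
    {V : Type v} [AddCommGroup V] [Module ℂ V] {ρ : Representation ℂ (GL (Fin 2) (ORing 𝔬 r)) V}
    (hρ : ρ.IsIrreducible) {x : V}
    (hx : IsEigenvector ρ (congruenceSubgroup _ (red_pow_mul_self hπ r))
      (nilpotentCharacter ψ) x) : IsRegular ρ := by
  refine ⟨hρ, ?_⟩
  rintro π' ψ' hπ' - A ⟨y, hy0, hy⟩
  have := finite_quotient_pow (𝔬 := 𝔬) r
  obtain hA | ⟨a, N, rfl⟩ := isCyclicMatrix_or_scalar hπ A (r / 2)
  · exact hA
  exfalso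
  obtain ⟨w, rfl⟩ := (IsDiscreteValuationRing.associated_of_irreducible 𝔬 hπ hπ').dvd
  obtain ⟨w', hw'⟩ := (IsDiscreteValuationRing.associated_of_irreducible 𝔬 hπ' hπ).dvd
  set π' := π * w with hπ'_def
  set c' := red 𝔬 r (π' ^ ((r + 1) / 2))
  have hc' : c' * c' = 0 := red_pow_mul_self hπ' r
  set B := (a • (1 : Matrix (Fin 2) (Fin 2) 𝔬) + π • N).map (red 𝔬 r) with hB
  -- Using `g - 1` in place of `π'^ℓ B` defines the character without choosing `B`.
  let χ' : GL (Fin 2) (ORing 𝔬 r) → ℂ := fun g =>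
    ψ' (B * ((g : Matrix (Fin 2) (Fin 2) (ORing 𝔬 r)) - 1)).trace
  have hx' : IsEigenvector ρ (congruenceSubgroup c' hc') (nilpotentCharacter ψ) x := by
    refine ⟨hx.1, fun k hk => hx.2 k ?_⟩
    obtain ⟨C, hC⟩ := hk
    refine ⟨red 𝔬 r (w ^ ((r + 1) / 2)) • C, ?_⟩
    rw [hC, smul_smul, ← map_mul, ← mul_pow]
  have hy' : IsEigenvector ρ (congruenceSubgroup c' hc') χ' y := by
    refine ⟨hy0, fun k hk => ?_⟩
    obtain ⟨C, hC⟩ := hk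
    rw [hy k C hC]
    simp only [χ', hC, add_sub_cancel_left, mul_smul_comm, Matrix.trace_smul, smul_eq_mul]
  obtain ⟨g, hg⟩ := exists_conj_of_isEigenvector ρ (congruenceSubgroup c' hc') hx' hy'
  set t := red 𝔬 r (π ^ (r - 1)) with ht
  -- As `r ≥ 2`, the exponent `r - 1` is at least `ℓ`, so `1 + tE` lies in the congruence subgroup.
  have htc : t = c' * red 𝔬 r (π ^ (r / 2 - 1) * w' ^ ((r + 1) / 2)) := by
    rw [ht, ← map_mul]
    congr 1
    calc π ^ (r - 1) = π ^ ((r + 1) / 2) * π ^ (r / 2 - 1) := by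
          rw [← pow_add]
          congr 1
          omega
      _ = _ := by
          nth_rewrite 1 [hw']
          ring
  have hm : SpecialLinearGroup.toGL (upperUnipotent t) ∈ congruenceSubgroup c' hc' := by
    rw [htc]
    exact upperUnipotent_mem hc' _
  have h1 := hg _ ((inferInstance : (congruenceSubgroup c' hc').Normal).conj_mem _ hm g)
  have h2 : g⁻¹ * (g * SpecialLinearGroup.toGL (upperUnipotent t) * g⁻¹) * g =
      SpecialLinearGroup.toGL (upperUnipotent t) := by group
  rw [h2] at h1
  have h3 : nilpotentCharacter ψ (SpecialLinearGroup.toGL (upperUnipotent t)) = ψ t := by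
    simp [nilpotentCharacter, coe_upperUnipotent]
  rw [h3] at h1
  apply hψ
  rw [← h1]
  let E : Matrix (Fin 2) (Fin 2) (ORing 𝔬 r) := !![0, 1; 0, 0]
  have h4 : ((g * SpecialLinearGroup.toGL (upperUnipotent t) * g⁻¹ : GL (Fin 2) (ORing 𝔬 r)) :
      Matrix (Fin 2) (Fin 2) (ORing 𝔬 r)) - 1 = t • (g * E * (g⁻¹ : GL (Fin 2) (ORing 𝔬 r))) := by
    have h5 : (SpecialLinearGroup.toGL (upperUnipotent t) :
        Matrix (Fin 2) (Fin 2) (ORing 𝔬 r)) = 1 + t • E := by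
      ext i j
      fin_cases i <;> fin_cases j <;> simp [coe_upperUnipotent, E]
    rw [Units.val_mul, Units.val_mul, h5, mul_add, add_mul, mul_one, Units.mul_inv,
      add_sub_cancel_left, mul_smul_comm, smul_mul_assoc]
  have h6 : B = red 𝔬 r a • (1 : Matrix (Fin 2) (Fin 2) (ORing 𝔬 r)) +
      red 𝔬 r π • N.map (red 𝔬 r) := by
    ext i j
    fin_cases i <;> fin_cases j <;> simp [hB]
  have h7 : t * red 𝔬 r π = 0 := by
    rw [ht, ← map_mul, red_eq_zero_iff hπ, ← pow_succ]
    exact pow_dvd_pow _ (by omega)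
  have h8 : (g * E * (g⁻¹ : GL (Fin 2) (ORing 𝔬 r)) :
      Matrix (Fin 2) (Fin 2) (ORing 𝔬 r)).trace = 0 := by
    rw [Matrix.trace_mul_comm, ← mul_assoc, Units.inv_mul, one_mul]
    simp [E, Matrix.trace_fin_two]
  simp only [χ']
  rw [h4, h6, add_mul, smul_mul_assoc, one_mul, smul_mul_smul_comm, mul_comm _ t, h7, zero_smul,
    add_zero, Matrix.trace_smul, Matrix.trace_smul, h8, smul_zero, smul_zero, AddChar.map_zero_eq_one]

theorem hasAtLeastConstituents_of_nilpotentCharacter [Finite (ResidueField 𝔬)] {π : 𝔬}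
    (hπ : Irreducible π) {r : ℕ} {ψ : AddChar (ORing 𝔬 r) ℂ}
    (hψ : ψ (red 𝔬 r (π ^ (r - 1))) ≠ 1) {V : Type v} [AddCommGroup V] [Module ℂ V]
    [FiniteDimensional ℂ V] (ρ : Representation ℂ (GL (Fin 2) (ORing 𝔬 r)) V) {x : V}
    (hx : IsEigenvector ρ (congruenceSubgroup _ (red_pow_mul_self hπ r))
      (nilpotentCharacter ψ) x) {n : ℕ} (u : Fin n → 𝔬ˣ)
    (hu : ∀ i j, i ≠ j → ∀ d : 𝔬, ¬ π ^ (r / 2) ∣ u j - d ^ 2 * u i) :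
    HasAtLeastConstituents (resSL ρ) n := by
  have := finite_quotient_pow (𝔬 := 𝔬) r
  have hc := red_pow_mul_self hπ r
  set c := red 𝔬 r (π ^ ((r + 1) / 2)) with hc_def
  let S := SpecialLinearGroup (Fin 2) (ORing 𝔬 r)
  let K : Subgroup S := (congruenceSubgroup c hc).comap SpecialLinearGroup.toGL
  let u' : Fin n → (ORing 𝔬 r)ˣ := fun i => Units.map (red 𝔬 r : 𝔬 →* ORing 𝔬 r) (u i)
  let χ : Fin n → S → ℂ := fun i s => nilpotentCharacter ψ
    ((diagUnit (u' i))⁻¹ * SpecialLinearGroup.toGL s * diagUnit (u' i))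
  have hex : ∀ i, IsEigenvector (resSL ρ) K (χ i) (ρ (diagUnit (u' i)) x) := by
    intro i
    have h := isEigenvector_conj ρ _ hx (diagUnit (u' i))
    exact ⟨h.1, fun k hk => h.2 (SpecialLinearGroup.toGL k) hk⟩
  choose W hW y hy using fun i => exists_irreducible_subrep (resSL ρ) K (χ i) (hex i)
  refine ⟨W, hW, fun i j hij => ⟨fun φ => ?_⟩⟩
  have hφ : IsEigenvector (W j).toRepresentation K (χ i) (φ (y i)) := by
    refine ⟨fun h => (hy i).1 (φ.injective (h.trans (map_zero φ).symm)), fun k hk => ?_⟩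
    have h : φ ((W i).toRepresentation k (y i)) = (W j).toRepresentation k (φ (y i)) :=
      Representation.IntertwiningMap.isIntertwining _ _ φ.toIntertwiningMap k (y i)
    rw [(hy i).2 k hk, map_smul] at h
    exact h.symm
  have := hW j
  obtain ⟨s, hs⟩ := exists_conj_of_isEigenvector (W j).toRepresentation K (hy j) hφ
  -- Conjugacy of the characters under `s` is only tested on the upper unipotents in `K`.
  have key : ∀ z, ψ (((u' i)⁻¹ : (ORing 𝔬 r)ˣ) * (c * z)) =
      ψ (((u' j)⁻¹ : (ORing 𝔬 r)ˣ) * s 1 1 ^ 2 * (c * z)) := by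
    intro z
    have h := hs (upperUnipotent (c * z)) (upperUnipotent_mem hc z)
    have h1 : χ i (upperUnipotent (c * z)) = ψ (((u' i)⁻¹ : (ORing 𝔬 r)ˣ) * (c * z)) := by
      simp only [χ]
      rw [nilpotentCharacter_conj (w := (((u' i)⁻¹ : (ORing 𝔬 r)ˣ) : ORing 𝔬 r))]
      · simp [diagUnit]
      · simp [diagUnit, Matrix.det_fin_two]
    have h2 : χ j (s⁻¹ * upperUnipotent (c * z) * s) =
        ψ (((u' j)⁻¹ : (ORing 𝔬 r)ˣ) * s 1 1 ^ 2 * (c * z)) := by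
      have h3 : (diagUnit (u' j))⁻¹ * SpecialLinearGroup.toGL (s⁻¹ * upperUnipotent (c * z) * s) *
          diagUnit (u' j) = (SpecialLinearGroup.toGL s * diagUnit (u' j))⁻¹ *
            SpecialLinearGroup.toGL (upperUnipotent (c * z)) *
            (SpecialLinearGroup.toGL s * diagUnit (u' j)) := by
        rw [map_mul, map_mul, map_inv]
        group
      simp only [χ]
      rw [h3, nilpotentCharacter_conj (w := (((u' j)⁻¹ : (ORing 𝔬 r)ˣ) : ORing 𝔬 r))]
      · simp [diagUnit, Matrix.mul_apply, Fin.sum_univ_two]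
      · rw [Units.val_mul, Matrix.det_mul]
        simp [diagUnit, Matrix.det_fin_two_of]
    rw [← h1, ← h2, h]
  have hzero : c * (((u' i)⁻¹ : (ORing 𝔬 r)ˣ) - ((u' j)⁻¹ : (ORing 𝔬 r)ˣ) * s 1 1 ^ 2) = 0 := by
    refine eq_zero_of_addChar_mul_eq_one hπ hψ fun z => ?_
    have h1 : c * ((((u' i)⁻¹ : (ORing 𝔬 r)ˣ) : ORing 𝔬 r) -
        ((u' j)⁻¹ : (ORing 𝔬 r)ˣ) * s 1 1 ^ 2) * z =
        ((u' i)⁻¹ : (ORing 𝔬 r)ˣ) * (c * z) -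
          ((u' j)⁻¹ : (ORing 𝔬 r)ˣ) * s 1 1 ^ 2 * (c * z) := by ring
    rw [h1, sub_eq_add_neg, AddChar.map_add_eq_mul, key, ← AddChar.map_add_eq_mul, add_neg_cancel,
      AddChar.map_zero_eq_one]
  obtain ⟨d, hd⟩ := Ideal.Quotient.mk_surjective (s 1 1)
  refine hu i j hij d ?_
  have h1 : c * ((u' j : ORing 𝔬 r) - s 1 1 ^ 2 * u' i) = 0 := by
    -- Multiplying `hzero` by both units clears the inverses.
    linear_combination (u' i : ORing 𝔬 r) * u' j * hzero - c * u' j * (u' i).mul_inv +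
      c * s 1 1 ^ 2 * u' i * (u' j).mul_inv
  have h2 : c * ((u' j : ORing 𝔬 r) - s 1 1 ^ 2 * u' i) =
      red 𝔬 r (π ^ ((r + 1) / 2) * (u j - d ^ 2 * u i)) := by
    rw [← hd]
    simp [u', hc_def]
  rw [h2, red_eq_zero_iff hπ] at h1
  -- Since `ℓ + ℓ' = r`, cancelling `π^ℓ` leaves a congruence modulo `π^ℓ'`.
  have h3 : π ^ ((r + 1) / 2) * π ^ (r / 2) ∣ π ^ ((r + 1) / 2) * (u j - d ^ 2 * u i) := by
    rw [← pow_add]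
    convert h1 using 2
    omega
  exact (mul_dvd_mul_iff_left (pow_ne_zero _ hπ.ne_zero)).1 h3

end Main

end RegularBranching

theorem theorem1p1 {𝔬 : Type u} [CommRing 𝔬] [IsDomain 𝔬] [IsDiscreteValuationRing 𝔬]
    [TopologicalSpace 𝔬] [CompactSpace 𝔬] (hadic : IsAdic (IsLocalRing.maximalIdeal 𝔬))
    [Finite (IsLocalRing.ResidueField 𝔬)] [CharP (IsLocalRing.ResidueField 𝔬) 2]
    (r : ℕ) (hr : 2 ≤ r) :
    ∃ (V : Type u) (_ : AddCommGroup V) (_ : Module ℂ V) (_ : FiniteDimensional ℂ V)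
      (ρ : Representation ℂ
        (Matrix.GeneralLinearGroup (Fin 2) (RegularBranching.ORing 𝔬 r)) V),
      RegularBranching.IsRegular ρ ∧
      RegularBranching.HasAtLeastConstituents (RegularBranching.resSL ρ)
        (RegularBranching.minNumber 𝔬 r) := by
  obtain ⟨π, hπ⟩ := IsDiscreteValuationRing.exists_irreducible 𝔬
  obtain ⟨ψ, hψ⟩ := RegularBranching.exists_addChar_ne_one hπ (r := r) (by omega)
  obtain ⟨u, hu⟩ := RegularBranching.exists_units_inequivalent_mod_squares hπ hr
  have := RegularBranching.finite_quotient_pow (𝔬 := 𝔬) r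
  obtain ⟨V, _, _, _, ρ, x, hρ, hx⟩ :=
    RegularBranching.exists_irreducible_nilpotentCharacter ψ _
      (RegularBranching.red_pow_mul_self hπ r)
  exact ⟨V, inferInstance, inferInstance, inferInstance, ρ,
    RegularBranching.isRegular_of_nilpotentCharacter hπ hr hψ hρ hx,
    RegularBranching.hasAtLeastConstituents_of_nilpotentCharacter hπ hψ ρ hx u hu⟩
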